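/- Let $\Gamma$ be a group generated by elements $g_1,\dots,g_n$ ($n\ge 1$), and let $C^*(\Gamma)$ be its full group $C^*$-algebra, with fundamental unitary $u=\mathrm{diag}(g_1,\dots,g_n)\in M_n(C^*(\Gamma))$. Let $C(\mathbb T)*C^*(\Gamma)$ be the full free product of unital $C^*$-algebras (amalgamated over $\mathbb C$), and let $z\in C(\mathbb T)$ be the identity function $z(x)=x$ on the unit circle. Let $\tilde C^*(\Gamma)\subset C(\mathbb T)*C^*(\Gamma)$ be the free complexification of $(C^*(\Gamma),u)$, that is, the $C^*$-subalgebra generated by the entries of $\tilde u=zu=\mathrm{diag}(zg_1,\dots,zg_n)$. Let $\Lambda=\langle g_i^{-1}g_j \mid i,j=1,\dots,n\rangle\subset\Gamma$. Then there is an isomorphism of $C^*$-algebras $$\tilde C^*(\Gamma)\simeq C^*(\mathbb Z*\Lambda),$$ where $\mathbb Z*\Lambda$ is the free product of groups. More precisely, writing $t$ for the canonical generator of $\mathbb Z$, for every $k\in\{1,\dots,n\}$ there is a $*$-isomorphism $\varphi:\tilde C^*(\Gamma)\to C^*(\mathbb Z*\Lambda)$ mapping the entries of $\tilde u$ to those of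 $\mathrm{diag}(t\,g_k^{-1}g_1,\dots,t\,g_k^{-1}g_n)$. -/

import Mathlib

universe u v

noncomputable section

namespace FreeComplexification

open scoped Pointwise in
theorem sSup_norm_smul (c : ℝ) (hc : 0 ≤ c) (s : Set ℝ) :
    sSup {r : ℝ | ∃ t ∈ s, r = c * t} = c * sSup s := by
  have h : {r : ℝ | ∃ t ∈ s, r = c * t} = c • s := by
    ext r
    simp only [Set.mem_smul_set, Set.mem_ofPred_eq, smul_eq_mul, eq_comm]
  rw [h, Real.sSup_smul_of_nonneg hc, smul_eq_mul]

/-! ### C*-seminorms and their completions -/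

/-- A C*-seminorm on a unital complex *-algebra: a submultiplicative seminorm satisfying the
C*-identity. -/
structure CStarSeminorm (R : Type u) [Ring R] [StarRing R] [Algebra ℂ R] extends
    Seminorm ℂ R where
  mul_le' : ∀ x y : R, toFun (x * y) ≤ toFun x * toFun y
  star_mul_self' : ∀ x : R, toFun (star x * x) = toFun x ^ 2

namespace CStarSeminorm

variable {R : Type u} [Ring R] [StarRing R] [Algebra ℂ R]

instance : CoeFun (CStarSeminorm R) (fun _ => R → ℝ) := ⟨fun p => p.toSeminorm⟩

theorem mul_le (p : CStarSeminorm R) (x y : R) : p (x * y) ≤ p x * p y := p.mul_le' x y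

theorem star_mul_self (p : CStarSeminorm R) (x : R) : p (star x * x) = p x ^ 2 :=
  p.star_mul_self' x

theorem nonneg (p : CStarSeminorm R) (x : R) : 0 ≤ p x := apply_nonneg p.toSeminorm x

theorem le_star (p : CStarSeminorm R) (x : R) : p x ≤ p (star x) := by
  have h := (p.star_mul_self x).symm.le.trans (p.mul_le (star x) x)
  rcases (p.nonneg x).eq_or_lt with h0 | h0
  · rw [← h0]; exact p.nonneg _
  · nlinarith

theorem map_star (p : CStarSeminorm R) (x : R) : p (star x) = p x :=
  le_antisymm (by simpa using p.le_star (star x)) (p.le_star x)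

/-- The pointwise supremum of a pointwise bounded set of C*-seminorms. -/
def sup (S : Set (CStarSeminorm R)) (hS : ∀ x : R, BddAbove {r : ℝ | ∃ p ∈ S, r = p x}) :
    CStarSeminorm R where
  toFun x := sSup {r : ℝ | ∃ p ∈ S, r = p x}
  map_zero' := by
    apply le_antisymm
    · apply Real.sSup_le _ le_rfl
      rintro r ⟨p, -, rfl⟩
      exact (map_zero p.toSeminorm).le
    · apply Real.sSup_nonneg
      rintro r ⟨p, -, rfl⟩
      exact p.nonneg _
  add_le' x y := by
    apply Real.sSup_le
    · rintro r ⟨p, hp, rfl⟩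
      exact (map_add_le_add p.toSeminorm x y).trans
        (add_le_add (le_csSup (hS x) ⟨p, hp, rfl⟩) (le_csSup (hS y) ⟨p, hp, rfl⟩))
    · apply add_nonneg <;>
      · apply Real.sSup_nonneg
        rintro r ⟨p, -, rfl⟩
        exact p.nonneg _
  neg' x := by
    congr 1
    ext r
    simp only [map_neg_eq_map]
  smul' a x := by
    rw [← sSup_norm_smul _ (norm_nonneg a)]
    congr 1
    ext r
    simp only [map_smul_eq_mul, Set.mem_ofPred_eq]
    constructor
    · rintro ⟨p, hp, rfl⟩
      exact ⟨_, ⟨p, hp, rfl⟩, rfl⟩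
    · rintro ⟨_, ⟨p, hp, rfl⟩, rfl⟩
      exact ⟨p, hp, rfl⟩
  mul_le' x y := by
    have h0 : ∀ z : R, 0 ≤ sSup {r : ℝ | ∃ p ∈ S, r = p z} := fun z => by
      apply Real.sSup_nonneg
      rintro r ⟨p, -, rfl⟩
      exact p.nonneg _
    apply Real.sSup_le
    · rintro r ⟨p, hp, rfl⟩
      exact (p.mul_le x y).trans
        (mul_le_mul (le_csSup (hS x) ⟨p, hp, rfl⟩) (le_csSup (hS y) ⟨p, hp, rfl⟩)
          (p.nonneg y) (h0 x))
    · exact mul_nonneg (h0 x) (h0 y)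
  star_mul_self' x := by
    have h0 : ∀ z : R, 0 ≤ sSup {r : ℝ | ∃ p ∈ S, r = p z} := fun z => by
      apply Real.sSup_nonneg
      rintro r ⟨p, -, rfl⟩
      exact p.nonneg _
    apply le_antisymm
    · apply Real.sSup_le
      · rintro r ⟨p, hp, rfl⟩
        rw [p.star_mul_self]
        exact pow_le_pow_left₀ (p.nonneg x) (le_csSup (hS x) ⟨p, hp, rfl⟩) 2
      · exact sq_nonneg _
    · have h1 : sSup {r : ℝ | ∃ p ∈ S, r = p x} ≤
          Real.sqrt (sSup {r : ℝ | ∃ p ∈ S, r = p (star x * x)}) := by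
        apply Real.sSup_le
        · rintro r ⟨p, hp, rfl⟩
          apply Real.le_sqrt_of_sq_le
          rw [← p.star_mul_self]
          exact le_csSup (hS _) ⟨p, hp, rfl⟩
        · exact Real.sqrt_nonneg _
      exact (pow_le_pow_left₀ (h0 x) h1 2).trans (Real.sq_sqrt (h0 _)).le

/-- The C*-seminorm `x ↦ ‖π x‖` defined by a *-representation `π` in a C*-algebra. -/
def ofRep {C : Type v} [CStarAlgebra C] (π : R →⋆ₐ[ℂ] C) : CStarSeminorm R where
  toFun x := ‖π x‖
  map_zero' := by simp
  add_le' x y := by rw [map_add]; exact norm_add_le _ _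
  neg' x := by simp
  smul' a x := by rw [map_smul, norm_smul]
  mul_le' x y := by rw [map_mul]; exact norm_mul_le _ _
  star_mul_self' x := by
    rw [map_mul, StarHomClass.map_star, CStarRing.norm_star_mul_self, sq]

/-- The *-algebra `R`, regarded as a topological *-algebra by means of the seminorm `p`. -/
def Carrier (_p : CStarSeminorm R) : Type u := R

variable (p : CStarSeminorm R)

instance : Ring p.Carrier := inferInstanceAs (Ring R)
instance : StarRing p.Carrier := inferInstanceAs (StarRing R)
instance : Algebra ℂ p.Carrier := inferInstanceAs (Algebra ℂ R)
instance [StarModule ℂ R] : StarModule ℂ p.Carrier := inferInstanceAs (StarModule ℂ R)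

instance : SeminormedRing p.Carrier where
  __ := (inferInstance : Ring p.Carrier)
  __ := p.toSeminorm.toAddGroupSeminorm.toSeminormedAddCommGroup
  norm_mul_le := p.mul_le

instance : NormedAlgebra ℂ p.Carrier where
  norm_smul_le a x := (map_smul_eq_mul p.toSeminorm a x).le

theorem Carrier.norm_def (x : p.Carrier) : ‖x‖ = p x := rfl

instance : NormedStarGroup p.Carrier where
  norm_star_le x := (p.map_star x).le

/-- The Hausdorff completion of `R` for the C*-seminorm `p`; it is a unital C*-algebra. -/
def Completion : Type u := UniformSpace.Completion p.Carrier

instance : NormedRing p.Completion :=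
  inferInstanceAs (NormedRing (UniformSpace.Completion p.Carrier))

instance : CompleteSpace p.Completion :=
  inferInstanceAs (CompleteSpace (UniformSpace.Completion p.Carrier))

instance : NormedAlgebra ℂ p.Completion where
  __ := (inferInstance : Algebra ℂ (UniformSpace.Completion p.Carrier))
  norm_smul_le a x := norm_smul_le a (show UniformSpace.Completion p.Carrier from x)

/-- The canonical map from `R` to its completion. -/
def coe (x : R) : p.Completion :=
  UniformSpace.Completion.coe' (α := p.Carrier) x

theorem norm_coe (x : R) : ‖p.coe x‖ = p x :=
  UniformSpace.Completion.norm_coe (E := p.Carrier) x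

theorem denseRange_coe : DenseRange p.coe :=
  UniformSpace.Completion.denseRange_coe (α := p.Carrier)

theorem coe_add (x y : R) : p.coe (x + y) = p.coe x + p.coe y :=
  UniformSpace.Completion.coe_add (α := p.Carrier) x y

theorem coe_mul (x y : R) : p.coe (x * y) = p.coe x * p.coe y :=
  UniformSpace.Completion.coe_mul (α := p.Carrier) x y

theorem coe_one : p.coe (1 : R) = 1 := UniformSpace.Completion.coe_one p.Carrier

theorem coe_smul (a : ℂ) (x : R) : p.coe (a • x) = a • p.coe x :=
  UniformSpace.Completion.coe_smul (X := p.Carrier) a x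

/-- The involution of the completion: the continuous extension of the involution of `R`. -/
instance : Star p.Completion where
  star := UniformSpace.Completion.map (star : p.Carrier → p.Carrier)

theorem continuous_star_completion : Continuous (star : p.Completion → p.Completion) :=
  UniformSpace.Completion.continuous_map

theorem uniformContinuous_star_carrier :
    UniformContinuous (star : p.Carrier → p.Carrier) :=
  (starₗᵢ ℤ : p.Carrier ≃ₗᵢ⋆[ℤ] p.Carrier).isometry.uniformContinuous

theorem coe_star (x : R) : p.coe (star x) = star (p.coe x) :=
  (UniformSpace.Completion.map_coe p.uniformContinuous_star_carrier x).symm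

theorem induction_on {P : p.Completion → Prop} (x : p.Completion)
    (hp : IsClosed {x | P x}) (ih : ∀ x : R, P (p.coe x)) : P x :=
  UniformSpace.Completion.induction_on (α := p.Carrier) x hp ih

theorem induction_on₂ {P : p.Completion → p.Completion → Prop} (x y : p.Completion)
    (hp : IsClosed {x : p.Completion × p.Completion | P x.1 x.2})
    (ih : ∀ x y : R, P (p.coe x) (p.coe y)) : P x y :=
  UniformSpace.Completion.induction_on₂ (α := p.Carrier) (β := p.Carrier) x y hp ih

instance : StarRing p.Completion where
  star_involutive x := by
    induction x using p.induction_on with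
    | hp =>
      exact isClosed_eq (p.continuous_star_completion.comp p.continuous_star_completion)
        continuous_id
    | ih x => rw [← coe_star, ← coe_star, star_star]
  star_mul x y := by
    induction x, y using p.induction_on₂ with
    | hp =>
      have := p.continuous_star_completion
      exact isClosed_eq (this.comp (continuous_fst.mul continuous_snd))
        ((this.comp continuous_snd).mul (this.comp continuous_fst))
    | ih x y => rw [← coe_mul, ← coe_star, ← coe_star, ← coe_star, ← coe_mul, star_mul]
  star_add x y := by
    induction x, y using p.induction_on₂ with
    | hp =>
      have := p.continuous_star_completion
      exact isClosed_eq (this.comp (continuous_fst.add continuous_snd))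
        ((this.comp continuous_fst).add (this.comp continuous_snd))
    | ih x y => rw [← coe_add, ← coe_star, ← coe_star, ← coe_star, ← coe_add, star_add]

instance : CStarRing p.Completion where
  norm_mul_self_le x := by
    induction x using p.induction_on with
    | hp =>
      exact isClosed_le (continuous_norm.mul continuous_norm)
        (continuous_norm.comp (p.continuous_star_completion.mul continuous_id))
    | ih x =>
      rw [← coe_star, ← coe_mul, norm_coe, norm_coe, star_mul_self, sq]

instance [StarModule ℂ R] : StarModule ℂ p.Completion where
  star_smul a x := by
    induction x using p.induction_on with
    | hp =>
      have := p.continuous_star_completion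
      exact isClosed_eq (this.comp (continuous_const_smul a)) (this.const_smul (star a))
    | ih x => rw [← coe_star, ← coe_smul, ← coe_star, ← coe_smul, star_smul]

instance [StarModule ℂ R] : CStarAlgebra p.Completion where

end CStarSeminorm

/-! ### The *-algebra of a monoid with involution -/

section MonoidStar

variable (M : Type u) [Monoid M]

/-- The involution `(∑ cₘ m)^* = ∑ conj(cₘ) m^*` on `ℂ[M]`, where `M` is a monoid with an
involution `m ↦ m^*` reversing products. -/
@[reducible] def monoidAlgebraStar (s : StarMul M) : Star (MonoidAlgebra ℂ M) where
  star x := x.coeff.sum fun m c => MonoidAlgebra.single (star m) (star c)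

theorem monoidAlgebraStar_single (s : StarMul M) (m : M) (c : ℂ) :
    (monoidAlgebraStar M s).star (MonoidAlgebra.single m c) =
      MonoidAlgebra.single (star m) (star c) := by
  change Finsupp.sum _ _ = _
  rw [MonoidAlgebra.coeff_single]
  exact Finsupp.sum_single_index (by simp)

theorem monoidAlgebraStar_zero (s : StarMul M) :
    (monoidAlgebraStar M s).star (0 : MonoidAlgebra ℂ M) = 0 := by
  change Finsupp.sum _ _ = _
  rw [MonoidAlgebra.coeff_zero, Finsupp.sum_zero_index]

theorem monoidAlgebraStar_add (s : StarMul M) (x y : MonoidAlgebra ℂ M) :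
    (monoidAlgebraStar M s).star (x + y) =
      (monoidAlgebraStar M s).star x + (monoidAlgebraStar M s).star y := by
  classical
  change Finsupp.sum _ _ = Finsupp.sum _ _ + Finsupp.sum _ _
  rw [MonoidAlgebra.coeff_add]
  apply Finsupp.sum_add_index
  · intros; simp
  · intros; simp [MonoidAlgebra.single_add]

/-- `ℂ[M]` is a *-ring. -/
@[reducible] def monoidAlgebraStarRing (s : StarMul M) : StarRing (MonoidAlgebra ℂ M) where
  __ := monoidAlgebraStar M s
  star_add := monoidAlgebraStar_add M s
  star_involutive x := by
    induction x using MonoidAlgebra.induction_linear with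
    | zero => rw [monoidAlgebraStar_zero, monoidAlgebraStar_zero]
    | add x y hx hy => rw [monoidAlgebraStar_add, monoidAlgebraStar_add, hx, hy]
    | single m c => simp [monoidAlgebraStar_single]
  star_mul x y := by
    induction x using MonoidAlgebra.induction_linear with
    | zero => rw [zero_mul, monoidAlgebraStar_zero, mul_zero]
    | add x x' hx hx' =>
      rw [add_mul, monoidAlgebraStar_add, monoidAlgebraStar_add, hx, hx', mul_add]
    | single m c =>
      induction y using MonoidAlgebra.induction_linear with
      | zero => rw [mul_zero, monoidAlgebraStar_zero, zero_mul]
      | add y y' hy hy' =>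
        rw [mul_add, monoidAlgebraStar_add, monoidAlgebraStar_add, hy, hy', add_mul]
      | single m' c' =>
        simp [monoidAlgebraStar_single, MonoidAlgebra.single_mul_single, mul_comm]

theorem monoidAlgebraStarModule (s : StarMul M) :
    @StarModule ℂ (MonoidAlgebra ℂ M) _ (monoidAlgebraStar M s) _ :=
  letI := monoidAlgebraStar M s
  { star_smul := fun a x => by
      induction x using MonoidAlgebra.induction_linear with
      | zero => rw [smul_zero, monoidAlgebraStar_zero, smul_zero]
      | add x y hx hy =>
        have := monoidAlgebraStar_add M s
        rw [smul_add, this, this, hx, hy, smul_add]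
      | single m c =>
        have := monoidAlgebraStar_single M s
        rw [MonoidAlgebra.smul_single, this, this, MonoidAlgebra.smul_single]
        simp }

end MonoidStar

/-! ### The full group C*-algebra -/

section Group

variable (Γ : Type u) [Group Γ]

/-- The involution `g ↦ g⁻¹` of a group. -/
@[reducible] def groupStarMul : StarMul Γ where
  star g := g⁻¹
  star_involutive := inv_inv
  star_mul := mul_inv_rev

/-- The complex group algebra `ℂ[Γ]`, with its *-algebra structure given by `g^* = g⁻¹`. -/
def GroupAlgebra : Type u := MonoidAlgebra ℂ Γ

namespace GroupAlgebra

instance : Ring (GroupAlgebra Γ) := inferInstanceAs (Ring (MonoidAlgebra ℂ Γ))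
instance : Algebra ℂ (GroupAlgebra Γ) := inferInstanceAs (Algebra ℂ (MonoidAlgebra ℂ Γ))
instance : StarRing (GroupAlgebra Γ) := monoidAlgebraStarRing Γ (groupStarMul Γ)
instance : StarModule ℂ (GroupAlgebra Γ) := monoidAlgebraStarModule Γ (groupStarMul Γ)

variable {Γ}

/-- The group element `g`, as an element of `ℂ[Γ]`. -/
def of : Γ →* GroupAlgebra Γ := MonoidAlgebra.of ℂ Γ

theorem induction_on {P : GroupAlgebra Γ → Prop} (x : GroupAlgebra Γ)
    (of : ∀ g, P (of g)) (add : ∀ x y, P x → P y → P (x + y))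
    (smul : ∀ (c : ℂ) (x), P x → P (c • x)) : P x :=
  MonoidAlgebra.induction_on (R := ℂ) (M := Γ) x of add smul

theorem star_of (g : Γ) : star (of g) = of g⁻¹ := by
  have h := monoidAlgebraStar_single Γ (groupStarMul Γ) g 1
  rw [star_one] at h
  exact h

/-- The linear extension to `ℂ[Γ]` of a unitary representation of `Γ` in a C*-algebra. -/
def lift {C : Type v} [CStarAlgebra C] (π : Γ →* unitary C) : GroupAlgebra Γ →⋆ₐ[ℂ] C where
  __ := (MonoidAlgebra.lift ℂ C Γ ((unitary C).subtype.comp π) : MonoidAlgebra ℂ Γ →ₐ[ℂ] C)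
  map_star' x := by
    change (MonoidAlgebra.lift ℂ C Γ ((unitary C).subtype.comp π)) (star x : GroupAlgebra Γ) =
      star ((MonoidAlgebra.lift ℂ C Γ ((unitary C).subtype.comp π)) x)
    induction x using GroupAlgebra.induction_on with
    | of g =>
      rw [star_of]
      refine (MonoidAlgebra.lift_of _ _).trans
        (Eq.trans ?_ (congrArg star (MonoidAlgebra.lift_of _ _).symm))
      simp [← Unitary.star_eq_inv]
    | add x y hx hy =>
      rw [star_add]
      exact (map_add _ _ _).trans ((congrArg₂ _ hx hy).trans
        ((star_add _ _).symm.trans (congrArg star (map_add _ _ _).symm)))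
    | smul c x hx =>
      rw [star_smul]
      exact (map_smul _ _ _).trans ((congrArg _ hx).trans
        ((star_smul _ _).symm.trans (congrArg star (map_smul _ _ _).symm)))

theorem lift_of {C : Type v} [CStarAlgebra C] (π : Γ →* unitary C) (g : Γ) :
    lift π (of g) = π g :=
  MonoidAlgebra.lift_of _ _

variable (Γ)

/-- The C*-seminorms on `ℂ[Γ]` defined by the unitary representations of `Γ` on Hilbert
spaces. -/
def repSeminorms : Set (CStarSeminorm (GroupAlgebra Γ)) :=
  {p | ∃ (H : Type u) (_ : NormedAddCommGroup H) (_ : InnerProductSpace ℂ H)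
    (_ : CompleteSpace H) (π : Γ →* unitary (H →L[ℂ] H)), p = CStarSeminorm.ofRep (lift π)}

theorem bddAbove_repSeminorms (x : GroupAlgebra Γ) :
    BddAbove {r : ℝ | ∃ p ∈ repSeminorms Γ, r = p x} := by
  suffices h : ∃ b : ℝ, ∀ p ∈ repSeminorms Γ, p x ≤ b by
    obtain ⟨b, hb⟩ := h
    exact ⟨b, by rintro r ⟨p, hp, rfl⟩; exact hb p hp⟩
  induction x using GroupAlgebra.induction_on with
  | of g =>
    refine ⟨1, ?_⟩
    rintro p ⟨H, _, _, _, π, rfl⟩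
    change ‖lift π (of g)‖ ≤ 1
    rw [lift_of]
    rcases subsingleton_or_nontrivial (H →L[ℂ] H) with hH | hH
    · rw [Subsingleton.elim (π g : H →L[ℂ] H) 0, norm_zero]
      exact zero_le_one
    · exact (CStarRing.norm_coe_unitary (π g)).le
  | add x y hx hy =>
    obtain ⟨a, ha⟩ := hx
    obtain ⟨b, hb⟩ := hy
    exact ⟨a + b, fun p hp => (map_add_le_add p.toSeminorm x y).trans
      (add_le_add (ha p hp) (hb p hp))⟩
  | smul c x hx =>
    obtain ⟨a, ha⟩ := hx
    refine ⟨‖c‖ * a, fun p hp => ?_⟩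
    rw [map_smul_eq_mul]
    exact mul_le_mul_of_nonneg_left (ha p hp) (norm_nonneg c)

/-- The norm of the full group C*-algebra:
`‖x‖ = sup {‖π(x)‖ : π a unitary representation of Γ on a Hilbert space}`. -/
def maxSeminorm : CStarSeminorm (GroupAlgebra Γ) :=
  CStarSeminorm.sup (repSeminorms Γ) (bddAbove_repSeminorms Γ)

end GroupAlgebra

/-- The full group C*-algebra `C*(Γ)`: the completion of `ℂ[Γ]` in the norm
`‖x‖ = sup {‖π(x)‖ : π a unitary representation of Γ on a Hilbert space}`. -/
def GroupCStar : Type u := (GroupAlgebra.maxSeminorm Γ).Completion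

instance : CStarAlgebra (GroupCStar Γ) :=
  inferInstanceAs (CStarAlgebra (GroupAlgebra.maxSeminorm Γ).Completion)

variable {Γ}

/-- The group element `g`, as an element of `C*(Γ)`. -/
def GroupCStar.of : Γ →* GroupCStar Γ where
  toFun g := (GroupAlgebra.maxSeminorm Γ).coe (GroupAlgebra.of g)
  map_one' := by rw [map_one]; exact CStarSeminorm.coe_one _
  map_mul' g h := by rw [map_mul]; exact CStarSeminorm.coe_mul _ _ _

end Group

/-! ### The free product of unital C*-algebras -/

section FreeProduct

open Monoid

variable (A : Type u) (B : Type v) [CStarAlgebra A] [CStarAlgebra B]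

/-- The involution on words in `A` and `B`: `(x₁ ⋯ xₖ)^* = xₖ^* ⋯ x₁^*`. -/
def wordStar : Coprod A B →* (Coprod A B)ᵐᵒᵖ :=
  Coprod.lift
    { toFun := fun a => MulOpposite.op (Coprod.inl (star a))
      map_one' := by simp
      map_mul' := fun a b => by simp }
    { toFun := fun a => MulOpposite.op (Coprod.inr (star a))
      map_one' := by simp
      map_mul' := fun a b => by simp }

/-- The monoid of words in `A` and `B`, with its involution. -/
@[reducible] def wordStarMul : StarMul (Coprod A B) where
  star w := (wordStar A B w).unop
  star_involutive w := by
    induction w using Coprod.induction_on with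
    | inl a => simp [wordStar]
    | inr b => simp [wordStar]
    | mul x y hx hy => simp [hx, hy]
  star_mul x y := by simp

/-- The *-algebra spanned by the words in `A` and `B` (products of elements of the
multiplicative monoids of `A` and `B`). The algebraic free product of `A` and `B` is the quotient
of this *-algebra by the linear relations of `A` and of `B`. -/
def WordAlgebra : Type (max u v) := MonoidAlgebra ℂ (Coprod A B)

namespace WordAlgebra

instance : Ring (WordAlgebra A B) := inferInstanceAs (Ring (MonoidAlgebra ℂ (Coprod A B)))
instance : Algebra ℂ (WordAlgebra A B) :=
  inferInstanceAs (Algebra ℂ (MonoidAlgebra ℂ (Coprod A B)))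
instance : StarRing (WordAlgebra A B) := monoidAlgebraStarRing _ (wordStarMul A B)
instance : StarModule ℂ (WordAlgebra A B) := monoidAlgebraStarModule _ (wordStarMul A B)

variable {A B}

/-- A word in `A` and `B`, as an element of the word algebra. -/
def of : Coprod A B →* WordAlgebra A B := MonoidAlgebra.of ℂ (Coprod A B)

theorem induction_on {P : WordAlgebra A B → Prop} (x : WordAlgebra A B)
    (of : ∀ g, P (of g)) (add : ∀ x y, P x → P y → P (x + y))
    (smul : ∀ (c : ℂ) (x), P x → P (c • x)) : P x :=
  MonoidAlgebra.induction_on (R := ℂ) (M := Coprod A B) x of add smul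

theorem star_of (w : Coprod A B) : star (of w) = of (wordStar A B w).unop := by
  have h := monoidAlgebraStar_single _ (wordStarMul A B) w 1
  rw [star_one] at h
  exact h

theorem lift_wordStar {C : Type*} [CStarAlgebra C] (σ : A →⋆ₐ[ℂ] C) (τ : B →⋆ₐ[ℂ] C)
    (w : Coprod A B) :
    Coprod.lift (σ : A →* C) (τ : B →* C) (wordStar A B w).unop =
      star (Coprod.lift (σ : A →* C) (τ : B →* C) w) := by
  induction w using Coprod.induction_on with
  | inl a => simp [wordStar, map_star]
  | inr b => simp [wordStar, map_star]
  | mul x y hx hy => simp [hx, hy]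

/-- The evaluation of words given by two unital *-homomorphisms `σ : A → C` and `τ : B → C`. -/
def lift {C : Type*} [CStarAlgebra C] (σ : A →⋆ₐ[ℂ] C) (τ : B →⋆ₐ[ℂ] C) :
    WordAlgebra A B →⋆ₐ[ℂ] C where
  __ := (MonoidAlgebra.lift ℂ C (Coprod A B) (Coprod.lift (σ : A →* C) (τ : B →* C)) :
    MonoidAlgebra ℂ (Coprod A B) →ₐ[ℂ] C)
  map_star' x := by
    change (MonoidAlgebra.lift ℂ C _ (Coprod.lift (σ : A →* C) (τ : B →* C))) (star x : WordAlgebra A B) =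
      star ((MonoidAlgebra.lift ℂ C _ (Coprod.lift (σ : A →* C) (τ : B →* C))) x)
    induction x using WordAlgebra.induction_on with
    | of w =>
      rw [star_of]
      exact (MonoidAlgebra.lift_of _ _).trans
        ((lift_wordStar σ τ w).trans (congrArg star (MonoidAlgebra.lift_of _ _).symm))
    | add x y hx hy =>
      rw [star_add]
      exact (map_add _ _ _).trans ((congrArg₂ _ hx hy).trans
        ((star_add _ _).symm.trans (congrArg star (map_add _ _ _).symm)))
    | smul c x hx =>
      rw [star_smul]
      exact (map_smul _ _ _).trans ((congrArg _ hx).trans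
        ((star_smul _ _).symm.trans (congrArg star (map_smul _ _ _).symm)))

theorem lift_of {C : Type*} [CStarAlgebra C] (σ : A →⋆ₐ[ℂ] C) (τ : B →⋆ₐ[ℂ] C)
    (w : Coprod A B) : lift σ τ (of w) = Coprod.lift (σ : A →* C) (τ : B →* C) w :=
  MonoidAlgebra.lift_of _ _

variable (A B)

/-- The C*-seminorms defined by the pairs of unital *-representations of `A` and `B` on the same
Hilbert space. -/
def repSeminorms : Set (CStarSeminorm (WordAlgebra A B)) :=
  {p | ∃ (H : Type (max u v)) (_ : NormedAddCommGroup H) (_ : InnerProductSpace ℂ H)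
    (_ : CompleteSpace H) (σ : A →⋆ₐ[ℂ] (H →L[ℂ] H)) (τ : B →⋆ₐ[ℂ] (H →L[ℂ] H)),
    p = CStarSeminorm.ofRep (lift σ τ)}

theorem bddAbove_repSeminorms (x : WordAlgebra A B) :
    BddAbove {r : ℝ | ∃ p ∈ repSeminorms A B, r = p x} := by
  suffices h : ∃ b : ℝ, ∀ p ∈ repSeminorms A B, p x ≤ b by
    obtain ⟨b, hb⟩ := h
    exact ⟨b, by rintro r ⟨p, hp, rfl⟩; exact hb p hp⟩
  induction x using WordAlgebra.induction_on with
  | of w =>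
    induction w using Coprod.induction_on with
    | inl a =>
      refine ⟨‖a‖, ?_⟩
      rintro p ⟨H, _, _, _, σ, τ, rfl⟩
      change ‖lift σ τ (of _)‖ ≤ _
      rw [lift_of, Coprod.lift_apply_inl]
      exact NonUnitalStarAlgHom.norm_apply_le σ a
    | inr b =>
      refine ⟨‖b‖, ?_⟩
      rintro p ⟨H, _, _, _, σ, τ, rfl⟩
      change ‖lift σ τ (of _)‖ ≤ _
      rw [lift_of, Coprod.lift_apply_inr]
      exact NonUnitalStarAlgHom.norm_apply_le τ b
    | mul x y hx hy =>
      obtain ⟨a, ha⟩ := hx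
      obtain ⟨b, hb⟩ := hy
      refine ⟨a * b, fun p hp => ?_⟩
      rw [map_mul]
      exact (p.mul_le _ _).trans (mul_le_mul (ha p hp) (hb p hp) (p.nonneg _)
        ((p.nonneg _).trans (ha p hp)))
  | add x y hx hy =>
    obtain ⟨a, ha⟩ := hx
    obtain ⟨b, hb⟩ := hy
    exact ⟨a + b, fun p hp => (map_add_le_add p.toSeminorm x y).trans
      (add_le_add (ha p hp) (hb p hp))⟩
  | smul c x hx =>
    obtain ⟨a, ha⟩ := hx
    refine ⟨‖c‖ * a, fun p hp => ?_⟩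
    rw [map_smul_eq_mul]
    exact mul_le_mul_of_nonneg_left (ha p hp) (norm_nonneg c)

/-- The norm of the free product: the supremum over all pairs of unital *-representations of `A`
and `B` on the same Hilbert space. -/
def maxSeminorm : CStarSeminorm (WordAlgebra A B) :=
  CStarSeminorm.sup (repSeminorms A B) (bddAbove_repSeminorms A B)

theorem maxSeminorm_eq_zero (x : WordAlgebra A B)
    (h : ∀ (H : Type (max u v)) [NormedAddCommGroup H] [InnerProductSpace ℂ H]
      [CompleteSpace H] (σ : A →⋆ₐ[ℂ] (H →L[ℂ] H)) (τ : B →⋆ₐ[ℂ] (H →L[ℂ] H)),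
      lift σ τ x = 0) : maxSeminorm A B x = 0 := by
  apply le_antisymm _ (CStarSeminorm.nonneg _ x)
  apply Real.sSup_le _ le_rfl
  rintro r ⟨p, ⟨H, _, _, _, σ, τ, rfl⟩, rfl⟩
  exact (norm_eq_zero.2 (h H σ τ)).le

variable {A B} in
theorem coe_eq_coe {x y : WordAlgebra A B}
    (h : ∀ (H : Type (max u v)) [NormedAddCommGroup H] [InnerProductSpace ℂ H]
      [CompleteSpace H] (σ : A →⋆ₐ[ℂ] (H →L[ℂ] H)) (τ : B →⋆ₐ[ℂ] (H →L[ℂ] H)),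
      lift σ τ x = lift σ τ y) :
    (maxSeminorm A B).coe x = (maxSeminorm A B).coe y := by
  have h0 := maxSeminorm_eq_zero A B (x + (-1 : ℂ) • y) (fun H _ _ _ σ τ => by
    rw [map_add, map_smul, h H σ τ]; simp)
  rw [← CStarSeminorm.norm_coe, norm_eq_zero, CStarSeminorm.coe_add, CStarSeminorm.coe_smul,
    neg_one_smul, ← sub_eq_add_neg] at h0
  exact sub_eq_zero.1 h0

end WordAlgebra

/-- The (full, unital) free product `A * B` of two unital C*-algebras: the completion of the
words in `A` and `B` in the seminorm given by the supremum over all pairs of unital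
*-representations of `A` and `B` on the same Hilbert space. -/
def FreeProduct : Type (max u v) := (WordAlgebra.maxSeminorm A B).Completion

instance : CStarAlgebra (FreeProduct A B) :=
  inferInstanceAs (CStarAlgebra (WordAlgebra.maxSeminorm A B).Completion)

namespace FreeProduct

variable {A B}

theorem coe_zero_smul (x : WordAlgebra A B) :
    (WordAlgebra.maxSeminorm A B).coe ((0 : ℂ) • x) = 0 := by
  rw [CStarSeminorm.coe_smul, zero_smul]

/-- The canonical *-homomorphism `A → A * B`. -/
def inl : A →⋆ₐ[ℂ] FreeProduct A B where
  toFun a := (WordAlgebra.maxSeminorm A B).coe (WordAlgebra.of (Coprod.inl a))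
  map_one' := by rw [map_one, map_one]; exact CStarSeminorm.coe_one _
  map_mul' a b := by rw [map_mul, map_mul]; exact CStarSeminorm.coe_mul _ _ _
  map_zero' := by
    refine Eq.trans (WordAlgebra.coe_eq_coe fun H _ _ _ σ τ => ?_) (coe_zero_smul 1)
    simp [WordAlgebra.lift_of]
  map_add' a b := by
    refine Eq.trans (WordAlgebra.coe_eq_coe fun H _ _ _ σ τ => ?_)
      (CStarSeminorm.coe_add _ _ _)
    simp [WordAlgebra.lift_of]
  commutes' c := by
    rw [Algebra.algebraMap_eq_smul_one, Algebra.algebraMap_eq_smul_one]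
    refine Eq.trans (WordAlgebra.coe_eq_coe (y := c • 1) fun H _ _ _ σ τ => ?_)
      ((CStarSeminorm.coe_smul _ _ _).trans (congrArg _ (CStarSeminorm.coe_one _)))
    simp [WordAlgebra.lift_of]
  map_star' a := by
    refine Eq.trans ?_ (CStarSeminorm.coe_star _ _)
    rw [WordAlgebra.star_of]
    simp [wordStar]
    rfl

/-- The canonical *-homomorphism `B → A * B`. -/
def inr : B →⋆ₐ[ℂ] FreeProduct A B where
  toFun b := (WordAlgebra.maxSeminorm A B).coe (WordAlgebra.of (Coprod.inr b))
  map_one' := by rw [map_one, map_one]; exact CStarSeminorm.coe_one _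
  map_mul' a b := by rw [map_mul, map_mul]; exact CStarSeminorm.coe_mul _ _ _
  map_zero' := by
    refine Eq.trans (WordAlgebra.coe_eq_coe fun H _ _ _ σ τ => ?_) (coe_zero_smul 1)
    simp [WordAlgebra.lift_of]
  map_add' a b := by
    refine Eq.trans (WordAlgebra.coe_eq_coe fun H _ _ _ σ τ => ?_)
      (CStarSeminorm.coe_add _ _ _)
    simp [WordAlgebra.lift_of]
  commutes' c := by
    rw [Algebra.algebraMap_eq_smul_one, Algebra.algebraMap_eq_smul_one]
    refine Eq.trans (WordAlgebra.coe_eq_coe (y := c • 1) fun H _ _ _ σ τ => ?_)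
      ((CStarSeminorm.coe_smul _ _ _).trans (congrArg _ (CStarSeminorm.coe_one _)))
    simp [WordAlgebra.lift_of]
  map_star' a := by
    refine Eq.trans ?_ (CStarSeminorm.coe_star _ _)
    rw [WordAlgebra.star_of]
    simp [wordStar]
    rfl

end FreeProduct

end FreeProduct

/-! ### Free complexification -/

section Complexification

/-- The identity function `z(x) = x` on the unit circle, as an element of `C(𝕋)`. -/
def circleZ : C(Circle, ℂ) := ⟨fun x => (x : ℂ), continuous_subtype_val⟩

variable {A : Type u} [CStarAlgebra A] {n : ℕ}

/-- The matrix `ũ = z u`, with entries in `C(𝕋) * A`. -/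
def tildeMatrix (u : Matrix (Fin n) (Fin n) A) :
    Matrix (Fin n) (Fin n) (FreeProduct C(Circle, ℂ) A) :=
  Matrix.of fun i j => FreeProduct.inl circleZ * FreeProduct.inr (u i j)

/-- The free complexification `Ã ⊆ C(𝕋) * A` of `(A, u)`: the closed *-subalgebra generated by
the entries of `ũ = z u`. -/
def tildeAlgebra (u : Matrix (Fin n) (Fin n) A) :
    StarSubalgebra ℂ (FreeProduct C(Circle, ℂ) A) :=
  (StarAlgebra.adjoin ℂ {x | ∃ i j, x = tildeMatrix u i j}).topologicalClosure

theorem tildeMatrix_mem (u : Matrix (Fin n) (Fin n) A) (i j : Fin n) :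
    tildeMatrix u i j ∈ tildeAlgebra u :=
  StarSubalgebra.le_topologicalClosure _ (StarAlgebra.subset_adjoin ℂ _ ⟨i, j, rfl⟩)

/-- The matrix `ũ = z u`, with entries in `Ã`. -/
def tilde (u : Matrix (Fin n) (Fin n) A) : Matrix (Fin n) (Fin n) (tildeAlgebra u) :=
  Matrix.of fun i j => ⟨tildeMatrix u i j, tildeMatrix_mem u i j⟩

instance (u : Matrix (Fin n) (Fin n) A) : CStarAlgebra (tildeAlgebra u) :=
  StarSubalgebra.cstarAlgebra _ (h_closed := StarSubalgebra.isClosed_topologicalClosure _)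

variable {Γ : Type u} [Group Γ]

/-- The matrix `diag(g₁, …, gₙ)` with entries in `C*(Γ)`. -/
def groupMatrix (g : Fin n → Γ) : Matrix (Fin n) (Fin n) (GroupCStar Γ) :=
  Matrix.diagonal fun i => GroupCStar.of (g i)

/-- The subgroup `Λ` generated by the elements `gᵢ⁻¹ gⱼ`. -/
def ratioSubgroup (g : Fin n → Γ) : Subgroup Γ :=
  Subgroup.closure {x | ∃ i j, x = (g i)⁻¹ * g j}

/-- The element `gᵢ⁻¹ gⱼ` of `Λ`. -/
def ratio (g : Fin n → Γ) (i j : Fin n) : ratioSubgroup g :=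
  ⟨(g i)⁻¹ * g j, Subgroup.subset_closure ⟨i, j, rfl⟩⟩

/-- The free product group `ℤ * Λ`. -/
abbrev IntFree (Λ : Type u) [Group Λ] : Type u := Monoid.Coprod (Multiplicative ℤ) Λ

/-- The element `t λ` of `ℤ * Λ`, where `t = 1` is the generator of `ℤ` and `λ ∈ Λ`. -/
def IntFree.word {Λ : Type u} [Group Λ] (l : Λ) : IntFree Λ :=
  Monoid.Coprod.inl (Multiplicative.ofAdd (1 : ℤ)) * Monoid.Coprod.inr l

end Complexification

end FreeComplexification

end

noncomputable section

/-! ### Weighted permutations of `ℓ²` -/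

section WeightedPerm

variable {ι : Type u} {H : Type v} [NormedAddCommGroup H] [InnerProductSpace ℂ H]

/-! Put h = g_k. Inside C(𝕋) * C*(Γ), the unitary z h and the elements of Λ define a homomorphism
from ℤ * Λ to the unitary group, with t ↦ z h. It extends to a *-homomorphism Ψ on C*(ℤ * Λ). The
theorem amounts to two facts: Ψ is isometric, and its range is the free complexification. The
isomorphism sought is then Ψ⁻¹.

Isometry (`norm_lift_intFreeUnitary`). Representations of C(𝕋) * C*(Γ) restrict to representations
of ℤ * Λ, so Ψ does not increase norms. Conversely, `exists_dilation` realises every unitary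
representation π of ℤ * Λ on H inside a representation of C(𝕋) * C*(Γ). Induce π|Λ to a
representation ρ of Γ on ℓ²(Γ/Λ, H), let U be π(t) on the fibre over the base coset and the identity
on the other fibres, and send z to U ρ(h)⁻¹. Then z h acts as U, and the base fibre is a copy of H
on which ℤ * Λ acts by π. This works for any subgroup Λ and any h in Γ.

Range. The element t g_k⁻¹ g_i goes to z g_k g_k⁻¹ g_i = z g_i, so the range contains the generators
z g_i; being closed, it contains the free complexification. Conversely z g_k and (z g_i)^* (z g_j) =
g_i⁻¹ g_j lie in the free complexification, and these generate the image of ℤ * Λ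
(`intFreeUnitary_mem_tildeAlgebra`). -/

theorem memℓp_weightedPerm (e : Equiv.Perm ι) (w : ι → H ≃ₗᵢ[ℂ] H) (f : lp (fun _ : ι => H) 2) :
    Memℓp (fun i => w i (f (e.symm i))) 2 := by
  apply memℓp_gen
  simp only [LinearIsometryEquiv.norm_map]
  exact e.symm.summable_iff.2 ((lp.memℓp f).summable (by norm_num))

/-- The isometry `f ↦ (i ↦ w i (f (e⁻¹ i)))` of `ℓ²(ι, H)`. -/
def lpWeightedPerm (e : Equiv.Perm ι) (w : ι → H ≃ₗᵢ[ℂ] H) :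
    lp (fun _ : ι => H) 2 →ₗᵢ[ℂ] lp (fun _ : ι => H) 2 where
  toFun f := ⟨fun i => w i (f (e.symm i)), memℓp_weightedPerm e w f⟩
  map_add' f g := lp.ext (funext fun i => (w i).map_add _ _)
  map_smul' c f := lp.ext (funext fun i => (w i).map_smul _ _)
  norm_map' f := by
    have h0 : (0 : ℝ) < (2 : ENNReal).toReal := by norm_num
    rw [lp.norm_eq_tsum_rpow h0, lp.norm_eq_tsum_rpow h0]
    congr 1
    exact (tsum_congr fun i => congrArg (· ^ _) ((w i).norm_map (f (e.symm i)))).trans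
      (e.symm.tsum_eq fun i => ‖f i‖ ^ (2 : ENNReal).toReal)

theorem lpWeightedPerm_apply (e : Equiv.Perm ι) (w : ι → H ≃ₗᵢ[ℂ] H)
    (f : lp (fun _ : ι => H) 2) (i : ι) : lpWeightedPerm e w f i = w i (f (e.symm i)) := rfl

/-- The weighted permutation of `ℓ²(ι, H)`, as a surjective isometry. -/
def lpWeightedPermEquiv (e : Equiv.Perm ι) (w : ι → H ≃ₗᵢ[ℂ] H) :
    lp (fun _ : ι => H) 2 ≃ₗᵢ[ℂ] lp (fun _ : ι => H) 2 :=
  LinearIsometryEquiv.ofSurjective (lpWeightedPerm e w) fun f =>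
    -- The preimage comes from solving w (e i) (f' i) = f (e i) for f', which puts the weights of
    -- the inverse at e i.
    ⟨lpWeightedPerm e.symm (fun i => (w (e i)).symm) f, lp.ext (funext fun i => by
      simp [lpWeightedPerm_apply])⟩

theorem lpWeightedPermEquiv_apply (e : Equiv.Perm ι) (w : ι → H ≃ₗᵢ[ℂ] H)
    (f : lp (fun _ : ι => H) 2) (i : ι) : lpWeightedPermEquiv e w f i = w i (f (e.symm i)) := rfl

/-- A fibre over a fixed point of the permutation is invariant. This is used for the action of Λ on
the base fibre and for the operator that represents t. -/
theorem lpWeightedPermEquiv_single [DecidableEq ι] (e : Equiv.Perm ι) (w : ι → H ≃ₗᵢ[ℂ] H)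
    {i : ι} (hi : e i = i) (x : H) :
    lpWeightedPermEquiv e w (lp.single 2 i x) = lp.single 2 i (w i x) := by
  have hi' : e.symm i = i := by rw [Equiv.symm_apply_eq, hi]
  refine lp.ext (funext fun j => ?_)
  rw [lpWeightedPermEquiv_apply]
  by_cases h : j = i
  · subst h
    rw [hi', lp.single_apply_self, lp.single_apply_self]
  · rw [lp.single_apply_ne _ _ _ h, lp.single_apply_ne, map_zero]
    rw [Ne, Equiv.symm_apply_eq, hi]
    exact h

end WeightedPerm

/-! ### Induced representations -/

section Induced

variable {Γ : Type u} [Group Γ] {Λ : Subgroup Γ} {H : Type v} [NormedAddCommGroup H]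
  [InnerProductSpace ℂ H]

/-- A section of `Γ → Γ ⧸ Λ` that maps the base coset to `1`. -/
def cosetSection (Λ : Subgroup Γ) (x : Γ ⧸ Λ) : Γ :=
  x.out * (((1 : Γ) : Γ ⧸ Λ).out)⁻¹

theorem cosetSection_one : cosetSection Λ ((1 : Γ) : Γ ⧸ Λ) = 1 :=
  mul_inv_cancel _

theorem mk_cosetSection (x : Γ ⧸ Λ) : ((cosetSection Λ x : Γ) : Γ ⧸ Λ) = x := by
  -- The representative of the base coset lies in Λ, so dividing by it on the right normalises the
  -- section without moving any coset.
  have h : (((1 : Γ) : Γ ⧸ Λ).out)⁻¹ ∈ Λ := by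
    have := QuotientGroup.eq.1 (QuotientGroup.out_eq' ((1 : Γ) : Γ ⧸ Λ))
    rwa [mul_one] at this
  rw [cosetSection, QuotientGroup.mk_mul_of_mem _ h, QuotientGroup.out_eq']

/-- The cocycle `(g, x) ↦ s(x)⁻¹ g s(g⁻¹ x)` in `Λ`, where `s` is a section of `Γ → Γ ⧸ Λ`. -/
def cosetCocycle (Λ : Subgroup Γ) (g : Γ) (x : Γ ⧸ Λ) : Λ :=
  ⟨(cosetSection Λ x)⁻¹ * (g * cosetSection Λ (g⁻¹ • x)), by
    -- Both s(x) and g s(g⁻¹ x) represent the coset x, so their quotient lies in Λ.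
    rw [← QuotientGroup.eq, mk_cosetSection, ← smul_eq_mul, ← MulAction.Quotient.smul_coe,
      mk_cosetSection, smul_inv_smul]⟩

/-- The product telescopes: the two middle values of the section, at g⁻¹ x, cancel. This identity
makes the induced representation multiplicative. -/
theorem cosetCocycle_mul (g h : Γ) (x : Γ ⧸ Λ) :
    cosetCocycle Λ (g * h) x = cosetCocycle Λ g x * cosetCocycle Λ h (g⁻¹ • x) := by
  ext
  simp [cosetCocycle, mul_assoc, mul_smul]

theorem cosetCocycle_one (x : Γ ⧸ Λ) : cosetCocycle Λ 1 x = 1 := by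
  ext
  simp [cosetCocycle]

theorem coe_smul_base (l : Λ) : (l : Γ) • ((1 : Γ) : Γ ⧸ Λ) = ((1 : Γ) : Γ ⧸ Λ) := by
  rw [MulAction.Quotient.smul_coe, smul_eq_mul, mul_one, QuotientGroup.eq]
  simp

/-- Here the normalisation of the section matters: it makes the base fibre carry the given
representation of Λ itself, and not a conjugate of it. -/
theorem cosetCocycle_base (l : Λ) : cosetCocycle Λ l ((1 : Γ) : Γ ⧸ Λ) = l := by
  ext
  have h : (l : Γ)⁻¹ • ((1 : Γ) : Γ ⧸ Λ) = ((1 : Γ) : Γ ⧸ Λ) := by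
    rw [inv_smul_eq_iff, coe_smul_base]
  simp only [cosetCocycle, h, cosetSection_one]
  simp

/-- The representation of `Γ` on `ℓ²(Γ ⧸ Λ, H)` induced by a unitary representation of `Λ`
on `H`. -/
def inducedRep (π : Λ →* (H ≃ₗᵢ[ℂ] H)) :
    Γ →* (lp (fun _ : Γ ⧸ Λ => H) 2 ≃ₗᵢ[ℂ] lp (fun _ : Γ ⧸ Λ => H) 2) where
  toFun g := lpWeightedPermEquiv (MulAction.toPerm g) fun x => π (cosetCocycle Λ g x)
  map_one' := by
    ext f : 1
    refine lp.ext (funext fun x => ?_)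
    rw [lpWeightedPermEquiv_apply, cosetCocycle_one, map_one]
    simp
  map_mul' g h := by
    ext f : 1
    refine lp.ext (funext fun x => ?_)
    simp only [LinearIsometryEquiv.coe_mul, Function.comp_apply, lpWeightedPermEquiv_apply,
      cosetCocycle_mul, map_mul, MulAction.toPerm_symm_apply, mul_inv_rev, mul_smul]

theorem inducedRep_single [DecidableEq (Γ ⧸ Λ)] (π : Λ →* (H ≃ₗᵢ[ℂ] H)) (l : Λ) (x : H) :
    inducedRep π (l : Γ) (lp.single 2 ((1 : Γ) : Γ ⧸ Λ) x) =
      lp.single 2 ((1 : Γ) : Γ ⧸ Λ) (π l x) := by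
  refine (lpWeightedPermEquiv_single _ _ (coe_smul_base l) x).trans ?_
  rw [cosetCocycle_base]

end Induced

/-! ### Representations of `C(𝕋)` -/

/-- The unital *-homomorphism `C(𝕋) → C` mapping the identity function to a given unitary. -/
theorem exists_starAlgHom_circle {C : Type u} [CStarAlgebra C] (w : unitary C) :
    ∃ σ : C(Circle, ℂ) →⋆ₐ[ℂ] C, σ FreeComplexification.circleZ = w := by
  -- The spectrum of a unitary lies in the circle, so a function on 𝕋 can be restricted to it and
  -- fed to the continuous functional calculus.
  let j : C(spectrum ℂ (w : C), Circle) :=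
    ⟨fun x => ⟨x, Unitary.spectrum_subset_circle w x.2⟩, by fun_prop⟩
  have hw : IsStarNormal (w : C) := inferInstance
  exact ⟨(cfcHom hw).comp (ContinuousMap.compStarAlgHom' ℂ ℂ j), cfcHom_id hw⟩

namespace FreeComplexification

/-! ### Extension of representations to completions -/

namespace CStarSeminorm

variable {R : Type u} [Ring R] [StarRing R] [Algebra ℂ R] (p : CStarSeminorm R)
  {C : Type v} [CStarAlgebra C]

/-- The extension to the completion of a *-homomorphism bounded by the seminorm. -/
theorem exists_extension (f : R →⋆ₐ[ℂ] C) (hf : ∀ x, ‖f x‖ ≤ p x) :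
    ∃ F : p.Completion →⋆ₐ[ℂ] C, Continuous F ∧ ∀ x, F (p.coe x) = f x := by
  let f' : p.Carrier →+ C := AddMonoidHomClass.toAddMonoidHom f
  have huc : UniformContinuous f' :=
    (AddMonoidHomClass.lipschitz_of_bound f' 1 fun x => by
      rw [one_mul]; exact hf x).uniformContinuous
  let F : p.Completion → C := UniformSpace.Completion.extension (α := p.Carrier) f'
  have hc : Continuous F :=
    UniformSpace.Completion.continuous_extension (α := p.Carrier)
  have hF : ∀ x, F (p.coe x) = f x := UniformSpace.Completion.extension_coe (α := p.Carrier) huc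
  refine ⟨{ toFun := F, map_one' := ?_, map_mul' := fun x y => ?_, map_zero' := ?_,
            map_add' := fun x y => ?_, commutes' := fun c => ?_, map_star' := fun x => ?_ },
    hc, hF⟩
  · rw [← coe_one, hF, map_one]
  · induction x, y using p.induction_on₂ with
    | hp =>
      exact isClosed_eq (hc.comp (continuous_fst.mul continuous_snd))
        ((hc.comp continuous_fst).mul (hc.comp continuous_snd))
    | ih x y => rw [← coe_mul, hF, hF, hF, map_mul]
  · have h : p.coe ((0 : ℂ) • 1) = 0 := by rw [coe_smul, zero_smul]
    rw [← h, hF, zero_smul, map_zero]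
  · induction x, y using p.induction_on₂ with
    | hp =>
      exact isClosed_eq (hc.comp (continuous_fst.add continuous_snd))
        ((hc.comp continuous_fst).add (hc.comp continuous_snd))
    | ih x y => rw [← coe_add, hF, hF, hF, map_add]
  · rw [Algebra.algebraMap_eq_smul_one, Algebra.algebraMap_eq_smul_one, ← coe_one, ← coe_smul,
      hF, map_smul, map_one]
  · induction x using p.induction_on with
    | hp =>
      exact isClosed_eq (hc.comp p.continuous_star_completion) hc.star
    | ih x => rw [← coe_star, hF, hF, StarHomClass.map_star]

end CStarSeminorm

/-! ### Universal properties -/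

namespace GroupCStar

variable {Γ : Type u} [Group Γ]

theorem star_of (g : Γ) : star (of g) = of g⁻¹ := by
  refine (CStarSeminorm.coe_star _ _).symm.trans ?_
  rw [GroupAlgebra.star_of]
  rfl

variable (Γ) in
/-- The group elements, as unitaries of `C*(Γ)`. -/
def unitaryOf : Γ →* unitary (GroupCStar Γ) :=
  of.codRestrict _ fun g => by
    rw [Unitary.mem_iff, star_of, ← map_mul, ← map_mul]
    simp

theorem norm_lift_le {H : Type u} [NormedAddCommGroup H] [InnerProductSpace ℂ H]
    [CompleteSpace H] (π : Γ →* unitary (H →L[ℂ] H)) (x : GroupAlgebra Γ) :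
    ‖GroupAlgebra.lift π x‖ ≤ GroupAlgebra.maxSeminorm Γ x :=
  le_csSup (GroupAlgebra.bddAbove_repSeminorms Γ x) ⟨_, ⟨H, _, _, _, π, rfl⟩, rfl⟩

theorem exists_rep {H : Type u} [NormedAddCommGroup H] [InnerProductSpace ℂ H]
    [CompleteSpace H] (π : Γ →* unitary (H →L[ℂ] H)) :
    ∃ F : GroupCStar Γ →⋆ₐ[ℂ] (H →L[ℂ] H), ∀ g, F (of g) = π g := by
  obtain ⟨F, -, hF⟩ := CStarSeminorm.exists_extension _ _ (norm_lift_le π)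
  exact ⟨F, fun g => (hF _).trans (GroupAlgebra.lift_of π g)⟩

theorem maxSeminorm_le {x : GroupAlgebra Γ} {r : ℝ} (hr : 0 ≤ r)
    (h : ∀ (H : Type u) [NormedAddCommGroup H] [InnerProductSpace ℂ H] [CompleteSpace H]
      (π : Γ →* unitary (H →L[ℂ] H)), ‖GroupAlgebra.lift π x‖ ≤ r) :
    GroupAlgebra.maxSeminorm Γ x ≤ r := by
  apply Real.sSup_le _ hr
  rintro _ ⟨_, ⟨H, _, _, _, π, rfl⟩, rfl⟩
  exact h H π

end GroupCStar

namespace FreeProduct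

variable {A : Type u} {B : Type v} [CStarAlgebra A] [CStarAlgebra B]

theorem norm_lift_le {H : Type (max u v)} [NormedAddCommGroup H] [InnerProductSpace ℂ H]
    [CompleteSpace H] (σ : A →⋆ₐ[ℂ] (H →L[ℂ] H)) (τ : B →⋆ₐ[ℂ] (H →L[ℂ] H))
    (x : WordAlgebra A B) :
    ‖WordAlgebra.lift σ τ x‖ ≤ WordAlgebra.maxSeminorm A B x :=
  le_csSup (WordAlgebra.bddAbove_repSeminorms A B x) ⟨_, ⟨H, _, _, _, σ, τ, rfl⟩, rfl⟩

theorem exists_rep {H : Type (max u v)} [NormedAddCommGroup H] [InnerProductSpace ℂ H]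
    [CompleteSpace H] (σ : A →⋆ₐ[ℂ] (H →L[ℂ] H)) (τ : B →⋆ₐ[ℂ] (H →L[ℂ] H)) :
    ∃ F : FreeProduct A B →⋆ₐ[ℂ] (H →L[ℂ] H),
      (∀ x, F ((WordAlgebra.maxSeminorm A B).coe x) = WordAlgebra.lift σ τ x) ∧
      (∀ a, F (inl a) = σ a) ∧ ∀ b, F (inr b) = τ b := by
  obtain ⟨F, -, hF⟩ := CStarSeminorm.exists_extension _ _ (norm_lift_le σ τ)
  refine ⟨F, hF, fun a => (hF _).trans ?_, fun b => (hF _).trans ?_⟩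
  · simp [WordAlgebra.lift_of]
  · simp [WordAlgebra.lift_of]

/-- The norm of an element of `A * B` is bounded by any common bound of the norms of its images in
representations on Hilbert spaces. -/
theorem norm_le {y : FreeProduct A B} {r : ℝ} (hr : 0 ≤ r)
    (h : ∀ (H : Type (max u v)) [NormedAddCommGroup H] [InnerProductSpace ℂ H]
      [CompleteSpace H] (F : FreeProduct A B →⋆ₐ[ℂ] (H →L[ℂ] H)), ‖F y‖ ≤ r) :
    ‖y‖ ≤ r := by
  refine le_of_forall_pos_le_add fun ε hε => ?_
  let q : WordAlgebra A B → FreeProduct A B := (WordAlgebra.maxSeminorm A B).coe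
  have hq : DenseRange q := (WordAlgebra.maxSeminorm A B).denseRange_coe
  -- The error ε / 2 is spent twice: once in passing from `F y` to `F (q x)`, and once in passing
  -- from `q x` back to `y`.
  obtain ⟨x, hx⟩ := Metric.denseRange_iff.1 hq y (ε / 2) (half_pos hε)
  rw [dist_eq_norm] at hx
  have h1 : ‖q x‖ ≤ r + ε / 2 := by
    refine (CStarSeminorm.norm_coe _ x).le.trans ?_
    refine Real.sSup_le ?_ (by positivity)
    -- The norm of `q x` is a supremum over pairs of representations, and each pair extends to a
    -- representation `F` of the completion, to which the hypothesis applies.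
    rintro _ ⟨_, ⟨H, _, _, _, σ, τ, rfl⟩, rfl⟩
    obtain ⟨F, hF, -⟩ := exists_rep σ τ
    change ‖WordAlgebra.lift σ τ x‖ ≤ _
    rw [← hF]
    have h2 : ‖F (y - q x)‖ ≤ ‖y - q x‖ := NonUnitalStarAlgHom.norm_apply_le F _
    rw [map_sub, norm_sub_rev] at h2
    have h3 := h H F
    have h4 := norm_le_norm_add_norm_sub' (F (q x)) (F y)
    change ‖F (q x)‖ ≤ _
    linarith
  have h5 := norm_le_norm_add_norm_sub' y (q x)
  linarith

end FreeProduct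

/-- The homomorphism between unitary groups given by a unital *-homomorphism. -/
def unitaryMap {A : Type u} {B : Type v} [CStarAlgebra A] [CStarAlgebra B] (f : A →⋆ₐ[ℂ] B) :
    unitary A →* unitary B :=
  ((f : A →* B).comp (unitary A).subtype).codRestrict _ fun a => by
    have h := Unitary.mem_iff.1 a.2
    constructor
    · change star (f a) * f a = 1
      rw [← StarHomClass.map_star, ← map_mul, h.1, map_one]
    · change f a * star (f a) = 1
      rw [← StarHomClass.map_star, ← map_mul, h.2, map_one]

/-- The identity function of the circle, as a unitary. -/
def circleUnitary : unitary C(Circle, ℂ) :=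
  ⟨circleZ, by
    rw [Unitary.mem_iff_star_mul_self]
    ext x
    change star (x : ℂ) * x = 1
    rw [← starRingEnd_apply, ← Circle.coe_inv_eq_conj, ← Circle.coe_mul, inv_mul_cancel,
      Circle.coe_one]⟩

theorem GroupAlgebra.comp_lift {Γ : Type u} [Group Γ] {A B : Type v} [CStarAlgebra A]
    [CStarAlgebra B] (f : A →⋆ₐ[ℂ] B) (π : Γ →* unitary A) (x : GroupAlgebra Γ) :
    f (GroupAlgebra.lift π x) = GroupAlgebra.lift ((unitaryMap f).comp π) x := by
  induction x using GroupAlgebra.induction_on with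
  | of g => rw [lift_of, lift_of]; rfl
  | add x y hx hy => rw [map_add, map_add, map_add, hx, hy]
  | smul c x hx => rw [map_smul, map_smul, map_smul, hx]

/-! ### The isometric embedding of C*(ℤ * Λ) in C(𝕋) * C*(Γ) -/

section

variable {Γ : Type u} [Group Γ] (Λ : Subgroup Γ) (h : Γ)

/-- The homomorphism from `ℤ * Λ` to the unitaries of `C(𝕋) * C*(Γ)` given by `t ↦ z h` and by
the inclusion `Λ ⊆ Γ`. -/
def intFreeUnitary : IntFree Λ →* unitary (FreeProduct C(Circle, ℂ) (GroupCStar Γ)) :=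
  Monoid.Coprod.lift
    (zpowersHom _ (unitaryMap FreeProduct.inl circleUnitary *
      unitaryMap FreeProduct.inr (GroupCStar.unitaryOf Γ h)))
    (((unitaryMap FreeProduct.inr).comp (GroupCStar.unitaryOf Γ)).comp Λ.subtype)

theorem intFreeUnitary_t :
    (intFreeUnitary Λ h (Monoid.Coprod.inl (Multiplicative.ofAdd (1 : ℤ))) :
      FreeProduct C(Circle, ℂ) (GroupCStar Γ)) =
      FreeProduct.inl circleZ * FreeProduct.inr (GroupCStar.of h) := by
  rw [intFreeUnitary, Monoid.Coprod.lift_apply_inl, zpowersHom_apply, toAdd_ofAdd, zpow_one]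
  rfl

theorem intFreeUnitary_inr (l : Λ) :
    (intFreeUnitary Λ h (Monoid.Coprod.inr l) : FreeProduct C(Circle, ℂ) (GroupCStar Γ)) =
      FreeProduct.inr (GroupCStar.of (l : Γ)) := by
  rw [intFreeUnitary, Monoid.Coprod.lift_apply_inr]
  rfl

theorem intFreeUnitary_word (l : Λ) :
    (intFreeUnitary Λ h (IntFree.word l) : FreeProduct C(Circle, ℂ) (GroupCStar Γ)) =
      FreeProduct.inl circleZ * FreeProduct.inr (GroupCStar.of (h * l)) := by
  rw [IntFree.word, map_mul, Submonoid.coe_mul, intFreeUnitary_t, intFreeUnitary_inr, mul_assoc,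
    ← map_mul, ← map_mul]

variable {Λ} in
/-- Every unitary representation `π` of `ℤ * Λ` is contained in a representation of
`C(𝕋) * C*(Γ)`, through `intFreeUnitary`. -/
theorem exists_dilation {H : Type u} [NormedAddCommGroup H] [InnerProductSpace ℂ H]
    [CompleteSpace H] (π : IntFree Λ →* unitary (H →L[ℂ] H)) :
    ∃ (K : Type u) (_ : NormedAddCommGroup K) (_ : InnerProductSpace ℂ K) (_ : CompleteSpace K)
      (V : H →ₗᵢ[ℂ] K) (F : FreeProduct C(Circle, ℂ) (GroupCStar Γ) →⋆ₐ[ℂ] (K →L[ℂ] K)),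
      ∀ w x, F (intFreeUnitary Λ h w) (V x) = V ((π w : H →L[ℂ] H) x) := by
  classical
  let e := Unitary.linearIsometryEquiv (𝕜 := ℂ) (H := H)
  let b : Γ ⧸ Λ := ((1 : Γ) : Γ ⧸ Λ)
  let K := lp (fun _ : Γ ⧸ Λ => H) 2
  let e' := Unitary.linearIsometryEquiv (𝕜 := ℂ) (H := K)
  let ρ : Γ →* (K ≃ₗᵢ[ℂ] K) := inducedRep ((e.toMonoidHom.comp π).comp Monoid.Coprod.inr)
  let t : IntFree Λ := Monoid.Coprod.inl (Multiplicative.ofAdd (1 : ℤ))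
  -- On the base fibre this is π(t); the identity on the other fibres keeps it unitary.
  let U : K ≃ₗᵢ[ℂ] K :=
    lpWeightedPermEquiv 1 (Function.update (fun _ => LinearIsometryEquiv.refl ℂ H) b (e (π t)))
  let V : H →ₗᵢ[ℂ] K :=
    ⟨lp.lsingle (E := fun _ : Γ ⧸ Λ => H) 2 b,
      lp.norm_single (E := fun _ : Γ ⧸ Λ => H) (by norm_num) b⟩
  -- The image of z is chosen so that the factor ρ(h) cancels and z h acts as `U`. No condition
  -- restricts it, since C(𝕋) and C*(Γ) are represented independently.
  obtain ⟨σ, hσ⟩ := exists_starAlgHom_circle (e'.symm (U * (ρ h)⁻¹))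
  obtain ⟨τ, hτ⟩ := GroupCStar.exists_rep (e'.symm.toMonoidHom.comp ρ)
  obtain ⟨F, -, hl, hr⟩ := FreeProduct.exists_rep σ τ
  refine ⟨K, inferInstance, inferInstance, inferInstance, V, F, ?_⟩
  have hΛ : ∀ (l : Λ) x, F (intFreeUnitary Λ h (Monoid.Coprod.inr l)) (V x) =
      V ((π (Monoid.Coprod.inr l) : H →L[ℂ] H) x) := fun l x => by
    rw [intFreeUnitary_inr, hr, hτ]
    exact inducedRep_single _ l x
  have ht : ∀ x, F (intFreeUnitary Λ h t) (V x) = V ((π t : H →L[ℂ] H) x) := fun x => by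
    have h1 : F (intFreeUnitary Λ h t) = (e'.symm U : K →L[ℂ] K) := by
      rw [intFreeUnitary_t, map_mul, hl, hr, hσ, hτ]
      change ((e'.symm (U * (ρ h)⁻¹) * e'.symm (ρ h) : unitary (K →L[ℂ] K)) : K →L[ℂ] K) = _
      rw [← map_mul, inv_mul_cancel_right]
    rw [h1]
    refine (lpWeightedPermEquiv_single 1 _ (i := b) rfl x).trans ?_
    rw [Function.update_self]
    rfl
  -- The elements on which `V` intertwines the two actions form a subgroup, so t and Λ suffice.
  let P : Subgroup (IntFree Λ) :=
    { carrier := {w | ∀ x, F (intFreeUnitary Λ h w) (V x) = V ((π w : H →L[ℂ] H) x)}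
      one_mem' := fun x => by simp
      mul_mem' := fun {v w} hv hw x => by
        rw [map_mul, map_mul, Submonoid.coe_mul, Submonoid.coe_mul, map_mul]
        change F _ (F _ _) = V ((π v : H →L[ℂ] H) ((π w : H →L[ℂ] H) x))
        rw [hw, hv]
      inv_mem' := fun {w} hw x => by
        have h1 : F (intFreeUnitary Λ h w⁻¹) * F (intFreeUnitary Λ h w) = 1 := by
          rw [← map_mul, ← Submonoid.coe_mul, ← map_mul, inv_mul_cancel, map_one,
            Submonoid.coe_one, map_one]
        have h2 : (π w : H →L[ℂ] H) * (π w⁻¹ : H →L[ℂ] H) = 1 := by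
          rw [← Submonoid.coe_mul, ← map_mul, mul_inv_cancel, map_one, Submonoid.coe_one]
        -- Intertwining for `w` at the vector π(w⁻¹) x gives F(w) V π(w⁻¹) x = V x; applying F(w⁻¹)
        -- yields the claim for `w⁻¹`.
        have h3 := hw ((π w⁻¹ : H →L[ℂ] H) x)
        rw [← mul_apply_eq_comp (π w : H →L[ℂ] H), h2,
          one_apply_eq_self] at h3
        rw [← h3, ← mul_apply_eq_comp, h1, one_apply_eq_self] }
  intro w
  change w ∈ P
  induction w using Monoid.Coprod.induction_on with
  | inl m =>
    obtain ⟨m, rfl⟩ := Multiplicative.ofAdd.surjective m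
    have h1 : Multiplicative.ofAdd m = Multiplicative.ofAdd (1 : ℤ) ^ m := by
      rw [← ofAdd_zsmul]; simp
    rw [h1, map_zpow]
    exact P.zpow_mem ht m
  | inr l => exact hΛ l
  | mul v w hv hw => exact P.mul_mem hv hw

/-- Both norms are suprema over Hilbert space representations. Restriction to ℤ * Λ gives one
inequality, and the dilation of each representation of ℤ * Λ gives the other. -/
theorem norm_lift_intFreeUnitary (x : GroupAlgebra (IntFree Λ)) :
    ‖GroupAlgebra.lift (intFreeUnitary Λ h) x‖ = GroupAlgebra.maxSeminorm (IntFree Λ) x := by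
  apply le_antisymm
  · refine FreeProduct.norm_le (CStarSeminorm.nonneg _ x) fun H _ _ _ F => ?_
    rw [GroupAlgebra.comp_lift]
    exact GroupCStar.norm_lift_le _ x
  · refine GroupCStar.maxSeminorm_le (norm_nonneg _) fun H _ _ _ π => ?_
    obtain ⟨K, _, _, _, V, F, hF⟩ := exists_dilation h π
    have hV : ∀ v, F (GroupAlgebra.lift (intFreeUnitary Λ h) x) (V v) =
        V (GroupAlgebra.lift π x v) := fun v => by
      induction x using GroupAlgebra.induction_on with
      | of w => rw [GroupAlgebra.lift_of, GroupAlgebra.lift_of, hF]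
      | add x y hx hy => simp only [map_add, add_apply, hx, hy]
      | smul c x hx => simp only [map_smul, smul_apply, hx]
    refine ContinuousLinearMap.opNorm_le_bound _ (norm_nonneg _) fun v => ?_
    -- As `V` is isometric, ‖π(x) v‖ is the norm of the image of x under `F`, applied to `V v`; and
    -- `F` is contractive.
    rw [← V.norm_map, ← hV, ← V.norm_map v]
    refine (ContinuousLinearMap.le_opNorm _ _).trans ?_
    gcongr
    exact NonUnitalStarAlgHom.norm_apply_le F _

/-- The embedding of `C*(ℤ * Λ)` in `C(𝕋) * C*(Γ)`; its image lies in every closed *-subalgebra that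
contains the image of `ℤ * Λ`. -/
theorem exists_isometric_starAlgHom :
    ∃ Ψ : GroupCStar (IntFree Λ) →⋆ₐ[ℂ] FreeProduct C(Circle, ℂ) (GroupCStar Γ),
      Isometry Ψ ∧ (∀ w, Ψ (GroupCStar.of w) = intFreeUnitary Λ h w) ∧
      ∀ S : StarSubalgebra ℂ (FreeProduct C(Circle, ℂ) (GroupCStar Γ)),
        IsClosed (S : Set (FreeProduct C(Circle, ℂ) (GroupCStar Γ))) →
        (∀ w, (intFreeUnitary Λ h w : FreeProduct C(Circle, ℂ) (GroupCStar Γ)) ∈ S) →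
        ∀ y, Ψ y ∈ S := by
  obtain ⟨Ψ, hc, hΨ⟩ := CStarSeminorm.exists_extension _
    (GroupAlgebra.lift (intFreeUnitary Λ h)) fun x => (norm_lift_intFreeUnitary Λ h x).le
  refine ⟨Ψ, AddMonoidHomClass.isometry_of_norm Ψ fun y => ?_,
    fun w => (hΨ _).trans (GroupAlgebra.lift_of _ w), fun S hS hw y => ?_⟩
  · induction y using CStarSeminorm.induction_on with
    | hp => exact isClosed_eq hc.norm continuous_norm
    | ih x =>
      rw [hΨ, norm_lift_intFreeUnitary]
      exact (CStarSeminorm.norm_coe _ x).symm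
  · induction y using CStarSeminorm.induction_on with
    | hp => exact hS.preimage hc
    | ih x =>
      refine Eq.mpr (congrArg (· ∈ S) (hΨ x)) ?_
      induction x using GroupAlgebra.induction_on with
      | of w => rw [GroupAlgebra.lift_of]; exact hw w
      | add x y hx hy => rw [map_add]; exact add_mem hx hy
      | smul c x hx => rw [map_smul]; exact S.smul_mem hx c

end

/-! ### Identification of the range with the free complexification -/

section

variable {Γ : Type u} [Group Γ] {n : ℕ} (g : Fin n → Γ)

theorem tildeMatrix_groupMatrix_diag (i : Fin n) :
    tildeMatrix (groupMatrix g) i i =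
      FreeProduct.inl circleZ * FreeProduct.inr (GroupCStar.of (g i)) := by
  rw [tildeMatrix, Matrix.of_apply, groupMatrix, Matrix.diagonal_apply_eq]

theorem intFreeUnitary_mem_tildeAlgebra (k : Fin n) (w : IntFree (ratioSubgroup g)) :
    (intFreeUnitary (ratioSubgroup g) (g k) w : FreeProduct C(Circle, ℂ) (GroupCStar Γ)) ∈
      tildeAlgebra (groupMatrix g) := by
  have hmem : ∀ i, FreeProduct.inl circleZ * FreeProduct.inr (GroupCStar.of (g i)) ∈
      tildeAlgebra (groupMatrix g) := fun i => by
    rw [← tildeMatrix_groupMatrix_diag]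
    exact tildeMatrix_mem _ i i
  let P : Subgroup (IntFree (ratioSubgroup g)) :=
    { carrier := {w | (intFreeUnitary (ratioSubgroup g) (g k) w :
        FreeProduct C(Circle, ℂ) (GroupCStar Γ)) ∈ tildeAlgebra (groupMatrix g)}
      one_mem' := by
        change _ ∈ tildeAlgebra (groupMatrix g)
        rw [map_one]
        exact one_mem _
      mul_mem' := fun {v w} hv hw => by
        change _ ∈ tildeAlgebra (groupMatrix g)
        rw [map_mul]
        exact mul_mem hv hw
      inv_mem' := fun {w} hw => by
        change _ ∈ tildeAlgebra (groupMatrix g)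
        rw [map_inv, ← Unitary.star_eq_inv]
        exact star_mem hw }
  change w ∈ P
  induction w using Monoid.Coprod.induction_on with
  | inl m =>
    obtain ⟨m, rfl⟩ := Multiplicative.ofAdd.surjective m
    have h1 : Multiplicative.ofAdd m = Multiplicative.ofAdd (1 : ℤ) ^ m := by
      rw [← ofAdd_zsmul]; simp
    rw [h1, map_zpow]
    refine P.zpow_mem ?_ m
    change _ ∈ tildeAlgebra (groupMatrix g)
    rw [intFreeUnitary_t]
    exact hmem k
  | inr l =>
    obtain ⟨l, hl⟩ := l
    induction hl using Subgroup.closure_induction with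
    | mem x hx =>
      obtain ⟨i, j, rfl⟩ := hx
      change _ ∈ tildeAlgebra (groupMatrix g)
      rw [intFreeUnitary_inr]
      -- In (z g_i)^* (z g_j) the factors z^* z meet and cancel, leaving the generator g_i⁻¹ g_j of
      -- Λ.
      have h2 := mul_mem (star_mem (hmem i)) (hmem j)
      have h3 : star (FreeProduct.inl (B := GroupCStar Γ) circleZ) *
          FreeProduct.inl circleZ = 1 := (unitaryMap FreeProduct.inl circleUnitary).2.1
      rw [star_mul, mul_assoc, ← mul_assoc (star (FreeProduct.inl circleZ)), h3, one_mul,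
        ← StarHomClass.map_star, GroupCStar.star_of, ← map_mul, ← map_mul] at h2
      exact h2
    | one => exact (congrArg (· ∈ P) (map_one Monoid.Coprod.inr)).mpr P.one_mem
    | mul x y hx hy hx' hy' =>
      exact (congrArg (· ∈ P) (map_mul Monoid.Coprod.inr (⟨x, hx⟩ : ratioSubgroup g)
        ⟨y, hy⟩)).mpr (P.mul_mem hx' hy')
    | inv x hx hx' =>
      exact (congrArg (· ∈ P) (map_inv Monoid.Coprod.inr (⟨x, hx⟩ : ratioSubgroup g))).mpr
        (P.inv_mem hx')
  | mul v w hv hw => exact P.mul_mem hv hw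

/-- The choice h = g_k makes the words t g_k⁻¹ g_i go to z g_i, so the isometric embedding becomes
onto the free complexification, and its inverse is the required map. -/
theorem exists_starAlgEquiv_tildeAlgebra (k : Fin n) :
    ∃ φ : tildeAlgebra (groupMatrix g) ≃⋆ₐ[ℂ] GroupCStar (IntFree (ratioSubgroup g)),
      ∀ i j : Fin n, φ (tilde (groupMatrix g) i j) =
        groupMatrix (fun l : Fin n => IntFree.word (ratio g k l)) i j := by
  obtain ⟨Ψ, hiso, hof, hS⟩ := exists_isometric_starAlgHom (ratioSubgroup g) (g k)
  have hmem := hS (tildeAlgebra (groupMatrix g))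
    (StarSubalgebra.isClosed_topologicalClosure _) (intFreeUnitary_mem_tildeAlgebra g k)
  have hgen : ∀ i j, Ψ (groupMatrix (fun l : Fin n => IntFree.word (ratio g k l)) i j) =
      tildeMatrix (groupMatrix g) i j := fun i j => by
    by_cases hij : i = j
    · subst hij
      rw [groupMatrix, Matrix.diagonal_apply_eq, hof, intFreeUnitary_word,
        tildeMatrix_groupMatrix_diag, ratio, mul_inv_cancel_left]
    · rw [groupMatrix, Matrix.diagonal_apply_ne _ hij, tildeMatrix, Matrix.of_apply, groupMatrix,
        Matrix.diagonal_apply_ne _ hij, map_zero, map_zero, mul_zero]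
  -- An isometry from a complete space has closed range, so a range containing the entries of ũ
  -- contains the closed *-subalgebra they generate.
  have hrange : tildeAlgebra (groupMatrix g) ≤ Ψ.range := by
    refine StarSubalgebra.topologicalClosure_minimal (StarAlgebra.adjoin_le ?_) ?_
    · rintro _ ⟨i, j, rfl⟩
      exact ⟨_, hgen i j⟩
    · exact hiso.isClosedEmbedding.isClosed_range
  let φ := StarAlgEquiv.ofBijective (Ψ.codRestrict (tildeAlgebra (groupMatrix g)) hmem)
    ⟨fun x y hxy => hiso.injective (congrArg Subtype.val hxy), fun y => by
      obtain ⟨x, hx⟩ := hrange y.2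
      exact ⟨x, Subtype.ext hx⟩⟩
  refine ⟨φ.symm, fun i j => ?_⟩
  rw [← φ.symm_apply_apply (groupMatrix _ i j)]
  exact congrArg φ.symm (Subtype.ext (hgen i j).symm)

end

end FreeComplexification

end

open FreeComplexification in
theorem theorem1p4 {Γ : Type u} [Group Γ] {n : ℕ} (hn : 1 ≤ n) (g : Fin n → Γ)
    (hg : Subgroup.closure (Set.range g) = ⊤) :
    Nonempty (tildeAlgebra (groupMatrix g) ≃⋆ₐ[ℂ] GroupCStar (IntFree (ratioSubgroup g))) ∧
    ∀ k : Fin n,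
      ∃ φ : tildeAlgebra (groupMatrix g) ≃⋆ₐ[ℂ] GroupCStar (IntFree (ratioSubgroup g)),
        ∀ i j : Fin n, φ (tilde (groupMatrix g) i j) =
          groupMatrix (fun l : Fin n => IntFree.word (ratio g k l)) i j := by
  refine ⟨?_, exists_starAlgEquiv_tildeAlgebra g⟩
  -- Any index k will do; n ≥ 1 ensures that there is one.
  obtain ⟨φ, -⟩ := exists_starAlgEquiv_tildeAlgebra g ⟨0, hn⟩
  exact ⟨φ⟩
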